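/- Let $S$ and $A$ be finite nonempty sets (states and actions) and let $P(s'\mid s,a)$ be a transition model. A policy $\pi$ assigns to each $s\in S$ a distribution $\pi(\cdot\mid s)$ on $A$; put $P(\pi)_{s,s'}=\sum_a\pi(a\mid s)P(s'\mid s,a)$. Assume that the mixing condition holds with a constant $\tau\ge 1$: $\|dP(\pi)-d'P(\pi)\|_1\le e^{-1/\tau}\|d-d'\|_1$ for every policy $\pi$ and all distributions $d,d'$ on $S$. Let $d_\pi$ be the stationary (state, action) distribution of $\pi$, i.e. the limiting law of $(s_t,a_t)$ under $\pi$ from every initial state, and let $\Delta_{d_\Pi}$ be the convex hull of the $d_\pi$ with $\pi$ deterministic. Let $l_1,\dots,l_L\in[0,1]^{S\times A}$ be the adversary's loss vectors and $\Delta_L$ the set of their convex combinations. For a loss $l$ let $\langle l,d\rangle=\sum_{s,a}l(s,a)d(s,a)$ and $$Q_{\pi,l}(s,a)=\mathbb E\Big[\sum_{t\ge1}\big(l(s_t,a_t)-\langle l,d_\pi\rangle\big)\,\Big|\,s_1=s,a_1=a,\pi\Big]$$ (the sum over $t$ of the expectations). Fix a horizon $T\ge1$. In round $t=1,2,\dots$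 the adversary picks a loss $l_t\in\Delta_L$ depending on $\pi_1,\dots,\pi_{t-1}$. The agent follows MDP-E: $\pi_1(\cdot\mid s)$ is uniform and, at each state $s$, the Multiplicative Weights Update with feedback $Q_{\pi_t,l_t}(s,\cdot)$ is used, $$\pi_{t+1}(a\mid s)=\frac{\pi_t(a\mid s)\,e^{-\mu Q_{\pi_t,l_t}(s,a)}}{\sum_{b\in A}\pi_t(b\mid s)\,e^{-\mu Q_{\pi_t,l_t}(s,b)}},\qquad \mu=\frac1{3\tau}\sqrt{\frac{8\log|A|}{T}} .$$ The adversary is a no-external-regret learner with respect to the agent's stationary distributions, i.e. $$\max_{l\in\Delta_L}\Big(\sum_{t=1}^T\langle l,d_{\pi_t}\rangle-\sum_{t=1}^T\langle l_t,d_{\pi_t}\rangle\Big)\le\sqrt{\frac{T\log L}{2}} .$$ Put $\hat l=\frac1T\sum_{t=1}^Tl_t$, $\hat d=\frac1T\sum_{t=1}^Td_{\pi_t}$ and $$\varepsilon_T=\sqrt{\frac{\log L}{2T}}+3\tau\sqrt{\frac{\log|A|}{2T}} .$$ Then $(\hat l,\hat d)$ is an $\varepsilon_T$-Nash equilibrium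 of the game: $\hat l\in\Delta_L$, $\hat d\in\Delta_{d_\Pi}$ and $$\max_{l\in\Delta_L}\langle l,\hat d\rangle-\varepsilon_T\;\le\;\langle\hat l,\hat d\rangle\;\le\;\min_{d\in\Delta_{d_\Pi}}\langle\hat l,d\rangle+\varepsilon_T .$$ -/

import Mathlib

open Filter Topology

namespace OnlineMDP

noncomputable section

variable {S A : Type*} [Fintype S] [Fintype A]

/-- A stationary (randomised) policy: a probability distribution over actions at every state. -/
abbrev Policy (S A : Type*) [Fintype A] := S → stdSimplex ℝ A

/-- A transition model `P(s' | s, a)`. -/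
abbrev Transition (S A : Type*) [Fintype S] := S → A → stdSimplex ℝ S

/-- The state transition matrix `P(π)`, with entries `∑ a, π(a | s) * P(s' | s, a)`. -/
def stateMatrix (P : Transition S A) (π : Policy S A) : Matrix S S ℝ :=
  fun s s' => ∑ a, π s a * P s a s'

/-- The mixing time condition with constant `τ`: every policy contracts the `ℓ¹` distance of
state distributions by the factor `exp (-1 / τ)`. -/
def HasMixingTime (P : Transition S A) (τ : ℝ) : Prop :=
  ∀ π : Policy S A, ∀ d ∈ stdSimplex ℝ S, ∀ d' ∈ stdSimplex ℝ S,
    ∑ s, |Matrix.vecMul d (stateMatrix P π) s - Matrix.vecMul d' (stateMatrix P π) s|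
      ≤ Real.exp (-1 / τ) * ∑ s, |d s - d' s|

/-- The law of (state, action) after `n` transitions under `π`, from the initial state
distribution `d₀`. -/
def occupancy [DecidableEq S] (P : Transition S A) (π : Policy S A) (d₀ : S → ℝ) (n : ℕ) :
    S × A → ℝ :=
  fun z => Matrix.vecMul d₀ (stateMatrix P π ^ n) z.1 * π z.1 z.2

/-- `d` is the limiting law of (state, action) under `π`, from every initial distribution. -/
def IsStationaryDist [DecidableEq S] (P : Transition S A) (π : Policy S A)
    (d : S × A → ℝ) : Prop :=
  ∀ d₀ ∈ stdSimplex ℝ S, Tendsto (fun n => occupancy P π d₀ n) atTop (𝓝 d)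

/-- The stationary (state, action) distribution `d_π`. Under the mixing time condition it exists
and is unique, see `isStationaryDist_stationaryDist` and `IsStationaryDist.eq_stationaryDist`. -/
def stationaryDist [DecidableEq S] (P : Transition S A) (π : Policy S A) : S × A → ℝ :=
  Classical.epsilon (IsStationaryDist P π)

/-- `⟨l, d⟩ = ∑ (s, a), l (s, a) * d (s, a)`. -/
def pairing (l d : S × A → ℝ) : ℝ := ∑ z, l z * d z

/-- The (state, action) transition matrix under `π`: from `(s, a)` the state moves to `s'` with
probability `P(s' | s, a)`, and then `a'` is drawn from `π(· | s')`. -/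
def pairMatrix (P : Transition S A) (π : Policy S A) : Matrix (S × A) (S × A) ℝ :=
  fun z z' => P z.1 z.2 z'.1 * π z'.1 z'.2

/-- The accumulated loss
`Q_{π,l}(s,a) = E[∑_{t ≥ 1} (l(s_t,a_t) - ⟨l, d_π⟩) | s_1 = s, a_1 = a, π]`. The `n`-th term is the
expected relative loss after `n` transitions. -/
def Q [DecidableEq S] [DecidableEq A] (P : Transition S A) (π : Policy S A) (l : S × A → ℝ)
    (s : S) (a : A) : ℝ :=
  ∑' n : ℕ, (Matrix.mulVec (pairMatrix P π ^ n) l (s, a) - pairing l (stationaryDist P π))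

/-- The uniform distribution over actions. -/
def uniformDist (A : Type*) [Fintype A] [Nonempty A] : stdSimplex ℝ A :=
  ⟨fun _ => 1 / (Fintype.card A : ℝ), fun _ => by positivity, by simp⟩

lemma mwu_denom_pos (μ : ℝ) (p : stdSimplex ℝ A) (k : A → ℝ) :
    0 < ∑ b, p b * Real.exp (-μ * k b) := by
  have h0 : ∀ b, 0 ≤ p b * Real.exp (-μ * k b) :=
    fun b => mul_nonneg (p.2.1 b) (Real.exp_pos _).le
  refine lt_of_le_of_ne (Finset.sum_nonneg fun b _ => h0 b) fun h => ?_
  have hz : ∀ b, p b = 0 := fun b => by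
    have := (Finset.sum_eq_zero_iff_of_nonneg fun b _ => h0 b).1 h.symm b (Finset.mem_univ b)
    exact (mul_eq_zero.1 this).resolve_right (Real.exp_pos _).ne'
  have h1 : ∑ b, p b = 1 := p.2.2
  simp [hz] at h1

/-- One step of Multiplicative Weights Update with learning rate `μ` and feedback `k`. -/
def mwuStep (μ : ℝ) (p : stdSimplex ℝ A) (k : A → ℝ) : stdSimplex ℝ A :=
  ⟨fun a => p a * Real.exp (-μ * k a) / ∑ b, p b * Real.exp (-μ * k b),
    fun a => div_nonneg (mul_nonneg (p.2.1 a) (Real.exp_pos _).le) (mwu_denom_pos μ p k).le,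
    by rw [← Finset.sum_div, div_self (mwu_denom_pos μ p k).ne']⟩

/-- MDP-Expert: in every state `s` the policy starts uniform and is updated by MWU with feedback
`Q_{π_t,l_t}(s, ·)`. Index `t : ℕ` is round `t + 1`. -/
def IsMDPExpert [DecidableEq S] [DecidableEq A] [Nonempty A] (P : Transition S A) (μ : ℝ)
    (l : ℕ → S × A → ℝ) (π : ℕ → Policy S A) : Prop :=
  (∀ s, π 0 s = uniformDist A) ∧
    ∀ t s, π (t + 1) s = mwuStep μ (π t s) (Q P (π t) (l t) s)

/-- `Δ_L`: all convex combinations of the loss vectors `ℓ 0, …, ℓ (L - 1)`. -/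
def lossSimplex {L : ℕ} (ℓ : Fin L → S × A → ℝ) : Set (S × A → ℝ) :=
  {l | ∃ x ∈ stdSimplex ℝ (Fin L), l = ∑ i, x i • ℓ i}

/-- A non-oblivious adversary: in each round it picks a loss in `Δ_L` as a function of the policies
that the agent used in all earlier rounds. -/
abbrev Adversary (S A : Type*) [Fintype S] [Fintype A] {L : ℕ} (ℓ : Fin L → S × A → ℝ) :=
  (t : ℕ) → (Fin t → Policy S A) → lossSimplex ℓ

/-- The loss `l_t` that the adversary picks when the agent plays the policies `π`. -/
def Adversary.loss {L : ℕ} {ℓ : Fin L → S × A → ℝ} (adv : Adversary S A ℓ)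
    (π : ℕ → Policy S A) (t : ℕ) : S × A → ℝ :=
  adv t (fun i => π i)

/-- The adversary's external regret against the fixed loss `l` after `T` rounds, with respect to
the stationary distributions of the agent's policies. -/
def adversaryRegret [DecidableEq S] (P : Transition S A) (π : ℕ → Policy S A)
    (lt : ℕ → S × A → ℝ) (T : ℕ) (l : S × A → ℝ) : ℝ :=
  ∑ t ∈ Finset.range T, pairing l (stationaryDist P (π t)) -
    ∑ t ∈ Finset.range T, pairing (lt t) (stationaryDist P (π t))

/-- A policy that plays one action with certainty in every state. -/
def Policy.IsDeterministic (π : Policy S A) : Prop := ∀ s, ∃ a, π s a = 1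

/-- The convex hull of the stationary distributions of all deterministic policies. -/
def stationaryHull [DecidableEq S] (P : Transition S A) : Set (S × A → ℝ) :=
  convexHull ℝ {d | ∃ π : Policy S A, π.IsDeterministic ∧ d = stationaryDist P π}

/-- `(l, d)` is an `ε`-Nash equilibrium of the zero-sum game in which the adversary maximises and
the agent minimises `⟨l, d⟩`. -/
def IsEpsNash [DecidableEq S] (P : Transition S A) {L : ℕ} (ℓ : Fin L → S × A → ℝ) (ε : ℝ)
    (l d : S × A → ℝ) : Prop :=
  l ∈ lossSimplex ℓ ∧ d ∈ stationaryHull P ∧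
    (∀ l' ∈ lossSimplex ℓ, pairing l' d - ε ≤ pairing l d) ∧
    ∀ d' ∈ stationaryHull P, pairing l d ≤ pairing l d' + ε

/-- The average of the first `T` terms of a sequence. -/
def timeAverage (T : ℕ) (f : ℕ → S × A → ℝ) : S × A → ℝ :=
  (T : ℝ)⁻¹ • ∑ t ∈ Finset.range T, f t

section WellDefined

lemma vecMul_stateMatrix_mem (P : Transition S A) (π : Policy S A) {d : S → ℝ}
    (hd : d ∈ stdSimplex ℝ S) : Matrix.vecMul d (stateMatrix P π) ∈ stdSimplex ℝ S := by
  refine ⟨fun s => Finset.sum_nonneg fun s' _ => mul_nonneg (hd.1 s') <|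
    Finset.sum_nonneg fun a _ => mul_nonneg ((π s').2.1 a) ((P s' a).2.1 s), ?_⟩
  have hP : ∀ s a, ∑ s', P s a s' = 1 := fun s a => (P s a).2.2
  have hπ : ∀ s, ∑ a, π s a = 1 := fun s => (π s).2.2
  simp only [Matrix.vecMul, dotProduct, stateMatrix]
  rw [Finset.sum_comm]
  simp_rw [← Finset.mul_sum]
  have : ∀ s, ∑ s', ∑ a, π s a * P s a s' = 1 := fun s => by
    rw [Finset.sum_comm]; simp [← Finset.mul_sum, hP, hπ]
  simp [this, hd.2]

variable [DecidableEq S]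

lemma vecMul_pow_mem (P : Transition S A) (π : Policy S A) {d : S → ℝ}
    (hd : d ∈ stdSimplex ℝ S) (n : ℕ) :
    Matrix.vecMul d (stateMatrix P π ^ n) ∈ stdSimplex ℝ S := by
  induction n with
  | zero => simpa using hd
  | succ n ih =>
    rw [pow_succ, ← Matrix.vecMul_vecMul]
    exact vecMul_stateMatrix_mem P π ih

lemma HasMixingTime.pow {P : Transition S A} {τ : ℝ} (h : HasMixingTime P τ) (π : Policy S A)
    {d d' : S → ℝ} (hd : d ∈ stdSimplex ℝ S) (hd' : d' ∈ stdSimplex ℝ S) (n : ℕ) :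
    ∑ s, |Matrix.vecMul d (stateMatrix P π ^ n) s - Matrix.vecMul d' (stateMatrix P π ^ n) s|
      ≤ Real.exp (-1 / τ) ^ n * ∑ s, |d s - d' s| := by
  induction n with
  | zero => simp
  | succ n ih =>
    simp only [pow_succ, ← Matrix.vecMul_vecMul]
    refine (h π _ (vecMul_pow_mem P π hd n) _ (vecMul_pow_mem P π hd' n)).trans ?_
    calc _ ≤ Real.exp (-1 / τ) * (Real.exp (-1 / τ) ^ n * ∑ s, |d s - d' s|) :=
          mul_le_mul_of_nonneg_left ih (Real.exp_pos _).le
      _ = _ := by ring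

/-- Under the mixing time condition the stationary distribution exists. -/
theorem isStationaryDist_stationaryDist [Nonempty S] {P : Transition S A} {τ : ℝ} (hτ : 0 < τ)
    (h : HasMixingTime P τ) (π : Policy S A) : IsStationaryDist P π (stationaryDist P π) := by
  refine Classical.epsilon_spec (p := IsStationaryDist P π) ?_
  set r := Real.exp (-1 / τ) with hr
  have hr1 : r < 1 := by
    rw [hr, Real.exp_lt_one_iff]
    exact div_neg_of_neg_of_pos (by norm_num) hτ
  have hr0 : 0 ≤ r := (Real.exp_pos _).le
  have key : ∀ d ∈ stdSimplex ℝ S, ∀ d' ∈ stdSimplex ℝ S, ∀ n,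
      dist (Matrix.vecMul d (stateMatrix P π ^ n)) (Matrix.vecMul d' (stateMatrix P π ^ n))
        ≤ (∑ s, |d s - d' s|) * r ^ n := by
    intro d hd d' hd' n
    have h1 := h.pow π hd hd' n
    rw [mul_comm] at h1
    refine (dist_pi_le_iff (by positivity)).2 fun s => ?_
    rw [Real.dist_eq]
    exact (Finset.single_le_sum (f := fun s => |Matrix.vecMul d (stateMatrix P π ^ n) s -
      Matrix.vecMul d' (stateMatrix P π ^ n) s|) (fun _ _ => abs_nonneg _)
      (Finset.mem_univ s)).trans h1
  obtain ⟨s₀⟩ := ‹Nonempty S›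
  set e : S → ℝ := Pi.single s₀ 1
  have he : e ∈ stdSimplex ℝ S := single_mem_stdSimplex ℝ s₀
  have hc : CauchySeq fun n => Matrix.vecMul e (stateMatrix P π ^ n) := by
    refine cauchySeq_of_le_geometric r
      (∑ s, |e s - Matrix.vecMul e (stateMatrix P π) s|) hr1 fun n => ?_
    have := key e he _ (vecMul_stateMatrix_mem P π he) n
    rwa [Matrix.vecMul_vecMul, ← pow_succ'] at this
  obtain ⟨m, hm⟩ := cauchySeq_tendsto_of_complete hc
  refine ⟨fun z => m z.1 * π z.1 z.2, fun d₀ hd₀ => ?_⟩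
  have hm' : Tendsto (fun n => Matrix.vecMul d₀ (stateMatrix P π ^ n)) atTop (𝓝 m) := by
    refine (tendsto_iff_of_dist ?_).1 hm
    refine squeeze_zero (fun _ => dist_nonneg) (key e he d₀ hd₀) ?_
    simpa using (tendsto_pow_atTop_nhds_zero_of_lt_one hr0 hr1).const_mul (∑ s, |e s - d₀ s|)
  refine tendsto_pi_nhds.2 fun z => ?_
  exact (tendsto_pi_nhds.1 hm' z.1).mul_const _

/-- Under the mixing time condition the stationary distribution is unique. -/
theorem IsStationaryDist.eq_stationaryDist [Nonempty S] {P : Transition S A} {τ : ℝ} (hτ : 0 < τ)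
    (h : HasMixingTime P τ) {π : Policy S A} {d : S × A → ℝ} (hd : IsStationaryDist P π d) :
    d = stationaryDist P π :=
  let s₀ := Classical.arbitrary S
  tendsto_nhds_unique (hd _ (single_mem_stdSimplex ℝ s₀))
    (isStationaryDist_stationaryDist hτ h π _ (single_mem_stdSimplex ℝ s₀))

end WellDefined

end

end OnlineMDP

/-! Let `c` be the average realised loss, the mean over rounds of `⟨l_t, d_{π_t}⟩`. The adversary's
regret bound puts every `⟨l, d̂⟩` below `c` plus the first term of `ε_T`; the agent's puts every
`⟨l̂, d⟩` above `c` minus the second. Since `l̂` and `d̂` are themselves admissible, both bounds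
apply to `⟨l̂, d̂⟩`, and together they give the equilibrium.

The agent's regret comes from the performance difference lemma `pairing_stationaryDist_sub`: `⟨l,
d_π⟩ - ⟨l, d_π'⟩` is the average of `∑ a, (π - π')(a | s) Q_{π,l}(s, a)` over the stationary states
of the comparator `π'`. These weights do not depend on the round, so the regret is an average of
statewise regrets, each bounded by `mwu_regret_le_of_tuned`. Mixing keeps the range of `Q` at a
state within `3τ` (`Q_sub_Q_le`).

That `d̂` is admissible follows from `stationaryDist_mem_stationaryHull`, by separation and greedy
policy improvement. -/

namespace OnlineMDP

/-! ### Regret of Multiplicative Weights -/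

section MultiplicativeWeights

variable {A : Type*} [Fintype A]

/-- Hoeffding's lemma for a distribution on a finite type. -/
theorem log_sum_exp_le_of_forall_sub_le (p : stdSimplex ℝ A) (k : A → ℝ) {R : ℝ}
    (hR : ∀ a b, k a - k b ≤ R) (μ : ℝ) :
    Real.log (∑ a, p a * Real.exp (-μ * k a)) ≤ -μ * ∑ a, p a * k a + μ ^ 2 * R ^ 2 / 8 := by
  have hp0 : ∀ a, 0 ≤ p a := p.2.1
  have hp1 : ∑ a, p a = 1 := p.2.2
  have hne : Nonempty A := by
    by_contra h
    rw [not_nonempty_iff] at h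
    simp at hp1
  obtain ⟨a₀, ha₀⟩ := Finite.exists_min k
  have hR0 : 0 ≤ R := by simpa using hR a₀ a₀
  let _ : MeasurableSpace A := ⊤
  have hsum : ∑ a, ENNReal.ofReal (p a) = 1 := by
    rw [← ENNReal.ofReal_sum_of_nonneg fun a _ => hp0 a, hp1, ENNReal.ofReal_one]
  let ν := (PMF.ofFintype _ hsum).toMeasure
  have hint : ∀ f : A → ℝ, ∫ a, f a ∂ν = ∑ a, p a * f a := fun f => by
    simp [ν, PMF.integral_eq_sum, hp0]
  -- As `a₀` minimises `k`, the values of `k` lie in an interval of length `R`; the variance proxy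
  -- `(R / 2) ^ 2` yields the constant `1 / 8`.
  have hG := (ProbabilityTheory.hasSubgaussianMGF_of_mem_Icc (μ := ν) (X := k) (a := k a₀)
    (b := k a₀ + R) (measurable_of_finite k).aemeasurable
    (.of_forall fun a => ⟨ha₀ a, by linarith [hR a a₀]⟩)).mgf_le (-μ)
  rw [ProbabilityTheory.mgf, hint, hint] at hG
  set m := ∑ a, p a * k a
  have hZ : ∑ a, p a * Real.exp (-μ * (k a - m))
      = Real.exp (μ * m) * ∑ a, p a * Real.exp (-μ * k a) := by
    rw [Finset.mul_sum]
    refine Finset.sum_congr rfl fun a _ => ?_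
    rw [show -μ * (k a - m) = μ * m + -μ * k a by ring, Real.exp_add]
    ring
  have hc : (((‖k a₀ + R - k a₀‖₊ / 2) ^ 2 : NNReal) : ℝ) * (-μ) ^ 2 / 2
      = μ ^ 2 * R ^ 2 / 8 := by
    push_cast
    rw [add_sub_cancel_left, Real.norm_of_nonneg hR0]
    ring
  rw [hZ, hc] at hG
  have hpos := mwu_denom_pos μ p k
  have := Real.log_le_log (mul_pos (Real.exp_pos _) hpos) hG
  rw [Real.log_mul (Real.exp_pos _).ne' hpos.ne', Real.log_exp, Real.log_exp] at this
  linarith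

theorem mwuStep_apply (μ : ℝ) (p : stdSimplex ℝ A) (k : A → ℝ) (a : A) :
    mwuStep μ p k a = p a * Real.exp (-μ * k a) / ∑ b, p b * Real.exp (-μ * k b) := rfl

/-- The log-weight of `a` changes by exactly `-μ * k a` minus the log of the normaliser, which
Hoeffding's lemma controls. The right side telescopes over rounds. -/
theorem mul_le_log_mwuStep_sub_log (μ : ℝ) (p : stdSimplex ℝ A) (k : A → ℝ) {R : ℝ}
    (hR : ∀ a b, k a - k b ≤ R) {a : A} (ha : 0 < p a) :
    μ * (∑ b, p b * k b - k a)
      ≤ Real.log (mwuStep μ p k a) - Real.log (p a) + μ ^ 2 * R ^ 2 / 8 := by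
  rw [mwuStep_apply, Real.log_div (mul_pos ha (Real.exp_pos _)).ne' (mwu_denom_pos μ p k).ne',
    Real.log_mul ha.ne' (Real.exp_pos _).ne', Real.log_exp]
  linarith [log_sum_exp_le_of_forall_sub_le p k hR μ]

variable [Nonempty A]

/-- The regret bound of Multiplicative Weights Update started at the uniform distribution. -/
theorem mwu_regret_le {μ R : ℝ} {p : ℕ → stdSimplex ℝ A} {k : ℕ → A → ℝ}
    (h0 : p 0 = uniformDist A) (hp : ∀ t, p (t + 1) = mwuStep μ (p t) (k t))
    (hR : ∀ t a b, k t a - k t b ≤ R) (q : stdSimplex ℝ A) (T : ℕ) :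
    μ * ∑ t ∈ Finset.range T, ∑ a, (p t a - q a) * k t a
      ≤ Real.log (Fintype.card A) + T * (μ ^ 2 * R ^ 2 / 8) := by
  have hpos : ∀ t a, 0 < p t a := by
    intro t
    induction t with
    | zero =>
      intro a
      rw [h0]
      change 0 < 1 / (Fintype.card A : ℝ)
      positivity
    | succ t ih =>
      intro a
      rw [hp, mwuStep_apply]
      exact div_pos (mul_pos (ih a) (Real.exp_pos _)) (mwu_denom_pos _ _ _)
  have hq1 : ∑ a, q a = 1 := q.2.2
  have hle1 : ∀ t a, p t a ≤ 1 := fun t a => by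
    have h1 : ∑ a, p t a = 1 := (p t).2.2
    rw [← h1]
    exact Finset.single_le_sum (f := fun a => p t a) (fun b _ => (p t).2.1 b) (Finset.mem_univ a)
  -- Against a fixed action the log-weights telescope: the last is at most `0`, the first is `-log
  -- |A|`. A mixed comparator `q` is then an average of fixed actions.
  have hpure : ∀ a, ∑ t ∈ Finset.range T, μ * (∑ b, p t b * k t b - k t a)
      ≤ Real.log (Fintype.card A) + T * (μ ^ 2 * R ^ 2 / 8) := by
    intro a
    calc _ ≤ ∑ t ∈ Finset.range T,
          (Real.log (p (t + 1) a) - Real.log (p t a) + μ ^ 2 * R ^ 2 / 8) := by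
          refine Finset.sum_le_sum fun t _ => ?_
          rw [hp]
          exact mul_le_log_mwuStep_sub_log μ (p t) (k t) (hR t) (hpos t a)
      _ = Real.log (p T a) - Real.log (p 0 a) + T * (μ ^ 2 * R ^ 2 / 8) := by
          rw [Finset.sum_add_distrib, Finset.sum_range_sub fun t => Real.log (p t a)]
          simp
      _ ≤ _ := by
          have h1 := Real.log_nonpos (hpos T a).le (hle1 T a)
          have h2 : Real.log (p 0 a) = -Real.log (Fintype.card A) := by
            rw [h0]
            change Real.log (1 / (Fintype.card A : ℝ)) = _
            rw [one_div, Real.log_inv]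
          linarith
  calc _ = ∑ a, q a * ∑ t ∈ Finset.range T, μ * (∑ b, p t b * k t b - k t a) := by
        simp_rw [Finset.mul_sum (s := Finset.range T)]
        rw [Finset.sum_comm]
        refine Finset.sum_congr rfl fun t _ => ?_
        have : ∀ a, q a * (μ * (∑ b, p t b * k t b - k t a))
            = μ * (q a * ∑ b, p t b * k t b - q a * k t a) := fun a => by ring
        simp_rw [this]
        rw [← Finset.mul_sum, Finset.sum_sub_distrib, ← Finset.sum_mul, hq1, one_mul]
        simp_rw [sub_mul]
        rw [Finset.sum_sub_distrib]
    _ ≤ ∑ a, q a * (Real.log (Fintype.card A) + T * (μ ^ 2 * R ^ 2 / 8)) :=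
        Finset.sum_le_sum fun a _ => mul_le_mul_of_nonneg_left (hpure a) (q.2.1 a)
    _ = _ := by rw [← Finset.sum_mul, hq1, one_mul]

/-- The regret bound of Multiplicative Weights Update with the learning rate tuned to the
horizon `T`. -/
theorem mwu_regret_le_of_tuned {R : ℝ} (hRpos : 0 < R) {T : ℕ} (hT : 1 ≤ T)
    {p : ℕ → stdSimplex ℝ A} {k : ℕ → A → ℝ} (h0 : p 0 = uniformDist A)
    (hp : ∀ t, p (t + 1)
      = mwuStep (√(8 * Real.log (Fintype.card A) / T) / R) (p t) (k t))
    (hR : ∀ t a b, k t a - k t b ≤ R) (q : stdSimplex ℝ A) :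
    ∑ t ∈ Finset.range T, ∑ a, (p t a - q a) * k t a
      ≤ T * (R * √(Real.log (Fintype.card A) / (2 * T))) := by
  have hT0 : (0 : ℝ) < T := by exact_mod_cast hT
  have hlog : 0 ≤ Real.log (Fintype.card A) :=
    Real.log_nonneg (by exact_mod_cast Fintype.card_pos)
  have h := mwu_regret_le h0 hp hR q T
  -- In terms of `x` the rate is `4 * x / R`, and the two terms of the regret bound are balanced,
  -- each `2 * T * x ^ 2`.
  set x := √(Real.log (Fintype.card A) / (2 * T)) with hx
  have hx_nonneg : 0 ≤ x := Real.sqrt_nonneg _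
  have hx2 : Real.log (Fintype.card A) = 2 * T * x ^ 2 := by
    rw [hx, Real.sq_sqrt (by positivity)]
    field_simp
  have hμ : √(8 * Real.log (Fintype.card A) / T) = 4 * x := by
    rw [show 8 * Real.log (Fintype.card A) / T = (4 * x) ^ 2 by rw [hx2]; field_simp; ring]
    exact Real.sqrt_sq (by positivity)
  rw [hμ] at h
  -- When `x = 0` the rate vanishes and cannot be divided out, but then there is only one action and
  -- no regret.
  rcases hx_nonneg.eq_or_lt with hx0 | hx0
  · have hc : Fintype.card A = 1 := by
      have h1 : Real.log (Fintype.card A) = 0 := by rw [hx2, ← hx0]; simp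
      have h2 : (0 : ℝ) < Fintype.card A := by exact_mod_cast Fintype.card_pos
      exact_mod_cast Real.eq_one_of_pos_of_log_eq_zero h2 h1
    obtain ⟨a₀, ha₀⟩ := Fintype.card_eq_one_iff.1 hc
    have hone : ∀ r : stdSimplex ℝ A, ∀ a, r a = 1 := fun r a => by
      have h1 : ∑ b, r b = 1 := r.2.2
      rwa [Fintype.sum_eq_single a fun b hb => absurd ((ha₀ b).trans (ha₀ a).symm) hb] at h1
    simp only [hone, sub_self, zero_mul, Finset.sum_const_zero]
    positivity
  · set G := ∑ t ∈ Finset.range T, ∑ a, (p t a - q a) * k t a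
    have h1 : 4 * x / R * G ≤ 4 * x / R * (T * (R * x)) := by
      refine h.trans (le_of_eq ?_)
      rw [hx2]
      field_simp
      ring
    exact le_of_mul_le_mul_left h1 (by positivity)

end MultiplicativeWeights

end OnlineMDP

namespace OnlineMDP

/-! ### Mixing, the accumulated loss and the performance difference lemma -/

section PerformanceDifference

open Matrix

variable {S A : Type*} [Fintype A]

/-- The mean of `v (s, ·)` over the actions drawn by `π` at `s`. -/
def policyMean (π : Policy S A) (v : S × A → ℝ) (s : S) : ℝ := ∑ a, π s a * v (s, a)

theorem policyMean_mem_Icc (π : Policy S A) {v : S × A → ℝ}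
    (hv : ∀ z, v z ∈ Set.Icc (0 : ℝ) 1) (s : S) : policyMean π v s ∈ Set.Icc (0 : ℝ) 1 := by
  refine ⟨Finset.sum_nonneg fun a _ => mul_nonneg ((π s).2.1 a) (hv _).1, ?_⟩
  have h1 : ∑ a, π s a = 1 := (π s).2.2
  rw [← h1]
  exact Finset.sum_le_sum fun a _ => mul_le_of_le_one_right ((π s).2.1 a) (hv _).2

variable [Fintype S]

theorem pairMatrix_mulVec_apply (P : Transition S A) (π : Policy S A) (v : S × A → ℝ)
    (z : S × A) :
    (pairMatrix P π *ᵥ v) z = (fun s => P z.1 z.2 s) ⬝ᵥ policyMean π v := by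
  simp [pairMatrix, mulVec, dotProduct, policyMean, Fintype.sum_prod_type, Finset.mul_sum,
    mul_assoc]

/-- Averaging over actions intertwines the pair chain with the state chain, to which the mixing
condition applies. -/
theorem policyMean_pairMatrix_mulVec (P : Transition S A) (π : Policy S A) (v : S × A → ℝ) :
    policyMean π (pairMatrix P π *ᵥ v) = stateMatrix P π *ᵥ policyMean π v := by
  ext s
  simp only [policyMean, pairMatrix_mulVec_apply]
  simp only [mulVec, dotProduct, stateMatrix, Finset.mul_sum, Finset.sum_mul]
  rw [Finset.sum_comm]
  exact Finset.sum_congr rfl fun s' _ => Finset.sum_congr rfl fun a _ => by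
    rw [mul_assoc]

theorem policyMean_pairMatrix_pow_mulVec [DecidableEq S] [DecidableEq A] (P : Transition S A)
    (π : Policy S A) (v : S × A → ℝ) (n : ℕ) :
    policyMean π (pairMatrix P π ^ n *ᵥ v) = stateMatrix P π ^ n *ᵥ policyMean π v := by
  induction n with
  | zero => simp
  | succ n ih =>
    rw [pow_succ', pow_succ', ← mulVec_mulVec, ← mulVec_mulVec, policyMean_pairMatrix_mulVec, ih]

/-- The first transition only produces the law of the next state, so `n + 1` pair steps leave `n`
state steps of contraction. The term at time `0` is therefore always treated apart. -/
theorem pairMatrix_pow_succ_mulVec_apply [DecidableEq S] [DecidableEq A] (P : Transition S A)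
    (π : Policy S A) (v : S × A → ℝ) (n : ℕ) (z : S × A) :
    (pairMatrix P π ^ (n + 1) *ᵥ v) z
      = (fun s => P z.1 z.2 s) ᵥ* stateMatrix P π ^ n ⬝ᵥ policyMean π v := by
  rw [pow_succ', ← mulVec_mulVec, pairMatrix_mulVec_apply, policyMean_pairMatrix_pow_mulVec,
    dotProduct_mulVec]

/-- Distributions that are close in `ℓ¹` have close expectations of a `[0, 1]`-valued function. -/
theorem dotProduct_sub_dotProduct_le {x y : S → ℝ} (hx : x ∈ stdSimplex ℝ S)
    (hy : y ∈ stdSimplex ℝ S) {v : S → ℝ} (hv : ∀ s, v s ∈ Set.Icc (0 : ℝ) 1) :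
    x ⬝ᵥ v - y ⬝ᵥ v ≤ (∑ s, |x s - y s|) / 2 := by
  -- Equal total masses allow centring `v` at `1 / 2`, which gains the factor `1 / 2`.
  have h1 : x ⬝ᵥ v - y ⬝ᵥ v = ∑ s, (x s - y s) * (v s - 1 / 2) := by
    simp only [mul_sub, Finset.sum_sub_distrib, ← Finset.sum_mul, hx.2, hy.2, sub_mul, dotProduct]
    ring
  rw [h1, Finset.sum_div]
  refine Finset.sum_le_sum fun s _ => (le_abs_self _).trans ?_
  rw [abs_mul, div_eq_mul_inv]
  refine mul_le_mul_of_nonneg_left ?_ (abs_nonneg _)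
  rw [abs_le]
  constructor <;> linarith [(hv s).1, (hv s).2]

theorem sum_abs_sub_le_two {x y : S → ℝ} (hx : x ∈ stdSimplex ℝ S) (hy : y ∈ stdSimplex ℝ S) :
    ∑ s, |x s - y s| ≤ 2 := by
  calc _ ≤ ∑ s, (x s + y s) := Finset.sum_le_sum fun s _ => by
        rw [abs_le]
        constructor <;> linarith [hx.1 s, hy.1 s]
    _ = 2 := by rw [Finset.sum_add_distrib, hx.2, hy.2]; norm_num

theorem exp_neg_one_div_lt_one {τ : ℝ} (hτ : 0 < τ) : Real.exp (-1 / τ) < 1 := by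
  rw [Real.exp_lt_one_iff]
  exact div_neg_of_neg_of_pos (by norm_num) hτ

theorem one_sub_exp_inv_le {τ : ℝ} (hτ : 0 < τ) : (1 - Real.exp (-1 / τ))⁻¹ ≤ τ + 1 := by
  have h1 : 1 / τ + 1 ≤ Real.exp (1 / τ) := Real.add_one_le_exp _
  have h2 : Real.exp (-1 / τ) ≤ (1 / τ + 1)⁻¹ := by
    rw [neg_div, Real.exp_neg]
    exact inv_anti₀ (by positivity) h1
  have h3 : (1 / τ + 1)⁻¹ = 1 - (τ + 1)⁻¹ := by field_simp; ring
  refine inv_le_of_inv_le₀ (by positivity) ?_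
  linarith

theorem pairing_eq_dotProduct_policyMean {π : Policy S A} {σ : S → ℝ} {d : S × A → ℝ}
    (h : ∀ z, d z = σ z.1 * π z.1 z.2) (l : S × A → ℝ) :
    pairing l d = σ ⬝ᵥ policyMean π l := by
  simp only [pairing, h, Fintype.sum_prod_type, dotProduct, policyMean, Finset.mul_sum]
  exact Finset.sum_congr rfl fun s _ => Finset.sum_congr rfl fun a _ => by ring

variable [DecidableEq S]

theorem vecMul_pow_eq_self {σ : S → ℝ} {M : Matrix S S ℝ} (h : σ ᵥ* M = σ) (n : ℕ) :
    σ ᵥ* M ^ n = σ := by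
  induction n with
  | zero => simp
  | succ n ih => rw [pow_succ, ← vecMul_vecMul, ih, h]

variable [Nonempty S] {P : Transition S A} {τ : ℝ}

/-- The stationary distribution of `π` draws a state from an invariant distribution of `P(π)` and
then an action from `π`. -/
theorem exists_invariant_stateDist (hτ : 0 < τ) (hP : HasMixingTime P τ) (π : Policy S A) :
    ∃ σ ∈ stdSimplex ℝ S, σ ᵥ* stateMatrix P π = σ ∧
      ∀ z, stationaryDist P π z = σ z.1 * π z.1 z.2 := by
  obtain ⟨s₀⟩ := ‹Nonempty S›
  have hs := single_mem_stdSimplex ℝ s₀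
  have hlim := tendsto_pi_nhds.1 (isStationaryDist_stationaryDist hτ hP π _ hs)
  have hσ : Tendsto (fun n => Pi.single s₀ (1 : ℝ) ᵥ* stateMatrix P π ^ n) atTop
      (𝓝 fun s => ∑ a, stationaryDist P π (s, a)) := by
    refine tendsto_pi_nhds.2 fun s => ?_
    have h1 : ∑ a, π s a = 1 := (π s).2.2
    refine (tendsto_finsetSum _ fun a _ => hlim (s, a)).congr fun n => ?_
    simp only [occupancy]
    rw [← Finset.mul_sum, h1, mul_one]
  refine ⟨_, (isClosed_stdSimplex ℝ S).mem_of_tendsto hσ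
    (Eventually.of_forall fun n => vecMul_pow_mem P π hs n), ?_, fun z => ?_⟩
  -- Invariance: the state laws and their shift by one step have the same limit.
  · refine tendsto_nhds_unique ?_ (hσ.comp (tendsto_add_atTop_nat 1))
    have hc : Continuous fun x : S → ℝ => x ᵥ* stateMatrix P π :=
      continuous_id.matrix_vecMul continuous_const
    refine ((hc.tendsto _).comp hσ).congr fun n => ?_
    rw [Function.comp_apply, Function.comp_apply, pow_succ, ← vecMul_vecMul]
  · exact tendsto_nhds_unique (hlim z) ((tendsto_pi_nhds.1 hσ z.1).mul_const _)

variable [DecidableEq A]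

/-- The invariant state law is fixed by every power, so mixing against it makes the terms decay
geometrically. The loss is arbitrary because separating functionals are later used as losses. -/
theorem summable_relative_loss (hτ : 0 < τ) (hP : HasMixingTime P τ) (π : Policy S A)
    (l : S × A → ℝ) (z : S × A) :
    Summable fun n => (pairMatrix P π ^ n *ᵥ l) z - pairing l (stationaryDist P π) := by
  obtain ⟨σ, hσ, hinv, hd⟩ := exists_invariant_stateDist hτ hP π
  rw [← summable_nat_add_iff 1]
  set C := ∑ s, |policyMean π l s| with hC
  refine Summable.of_norm_bounded (g := fun n => Real.exp (-1 / τ) ^ n * (2 * C))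
    ((summable_geometric_of_lt_one (Real.exp_pos _).le (exp_neg_one_div_lt_one hτ)).mul_right _)
    fun n => ?_
  have hz : (fun s => P z.1 z.2 s) ∈ stdSimplex ℝ S := (P z.1 z.2).2
  have h1 := hP.pow π hz hσ n
  rw [pairMatrix_pow_succ_mulVec_apply, pairing_eq_dotProduct_policyMean hd,
    ← sub_dotProduct, Real.norm_eq_abs]
  rw [vecMul_pow_eq_self hinv] at h1
  calc _ ≤ ∑ s, |((fun s => P z.1 z.2 s) ᵥ* stateMatrix P π ^ n - σ) s * policyMean π l s| :=
        Finset.abs_sum_le_sum_abs _ _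
    _ ≤ ∑ s, |((fun s => P z.1 z.2 s) ᵥ* stateMatrix P π ^ n) s - σ s| * C := by
        refine Finset.sum_le_sum fun s _ => ?_
        rw [abs_mul, Pi.sub_apply]
        exact mul_le_mul_of_nonneg_left (Finset.single_le_sum (f := fun s => |policyMean π l s|)
          (fun _ _ => abs_nonneg _) (Finset.mem_univ s)) (abs_nonneg _)
    _ ≤ (Real.exp (-1 / τ) ^ n * 2) * C := by
        rw [← Finset.sum_mul]
        refine mul_le_mul_of_nonneg_right (h1.trans ?_) (Finset.sum_nonneg fun _ _ => abs_nonneg _)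
        exact mul_le_mul_of_nonneg_left (sum_abs_sub_le_two hz hσ) (by positivity)
    _ = _ := by ring

/-- The Poisson equation for the accumulated loss. -/
theorem Q_eq (hτ : 0 < τ) (hP : HasMixingTime P τ) (π : Policy S A) (l : S × A → ℝ) (s : S)
    (a : A) :
    Q P π l s a = l (s, a) - pairing l (stationaryDist P π)
      + ∑ s', P s a s' * ∑ a', π s' a' * Q P π l s' a' := by
  have hsum := summable_relative_loss hτ hP π l
  set ρ := pairing l (stationaryDist P π) with hρ
  rw [Q, (hsum (s, a)).tsum_eq_zero_add]
  congr 1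
  · simp
  -- Conditioning on the first transition; `ρ` passes inside because the transition weights sum to
  -- one.
  · have hstep : ∀ n, (pairMatrix P π ^ (n + 1) *ᵥ l) (s, a) - ρ
        = ∑ s', ∑ a', P s a s' * π s' a' * ((pairMatrix P π ^ n *ᵥ l) (s', a') - ρ) := by
      intro n
      have hP1 : ∑ s', P s a s' = 1 := (P s a).2.2
      have hπ1 : ∀ s', ∑ a', π s' a' = 1 := fun s' => (π s').2.2
      simp_rw [mul_sub, Finset.sum_sub_distrib, ← Finset.sum_mul, ← Finset.mul_sum, hπ1, mul_one,
        hP1, one_mul]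
      rw [pow_succ', ← mulVec_mulVec]
      simp [mulVec, dotProduct, Fintype.sum_prod_type, pairMatrix]
    simp_rw [hstep]
    rw [Summable.tsum_finsetSum fun s' _ => summable_sum fun a' _ =>
      (hsum (s', a')).mul_left _]
    refine Finset.sum_congr rfl fun s' _ => ?_
    rw [Summable.tsum_finsetSum fun a' _ => (hsum (s', a')).mul_left _, Finset.mul_sum]
    refine Finset.sum_congr rfl fun a' _ => ?_
    rw [tsum_mul_left, mul_assoc]
    rfl

omit [Nonempty S] in
/-- The expected losses of two initial actions approach each other geometrically. -/
theorem pairMatrix_pow_succ_mulVec_sub_le (hP : HasMixingTime P τ) (π : Policy S A)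
    {l : S × A → ℝ} (hl : ∀ z, l z ∈ Set.Icc (0 : ℝ) 1) (z w : S × A) (n : ℕ) :
    (pairMatrix P π ^ (n + 1) *ᵥ l) z - (pairMatrix P π ^ (n + 1) *ᵥ l) w
      ≤ Real.exp (-1 / τ) ^ n := by
  have hz : (fun s' => P z.1 z.2 s') ∈ stdSimplex ℝ S := (P z.1 z.2).2
  have hw : (fun s' => P w.1 w.2 s') ∈ stdSimplex ℝ S := (P w.1 w.2).2
  rw [pairMatrix_pow_succ_mulVec_apply, pairMatrix_pow_succ_mulVec_apply]
  have h1 := dotProduct_sub_dotProduct_le (vecMul_pow_mem P π hz n) (vecMul_pow_mem P π hw n)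
    (policyMean_mem_Icc π hl)
  have h2 := hP.pow π hz hw n
  have h3 := mul_le_mul_of_nonneg_left (sum_abs_sub_le_two hz hw)
    (pow_nonneg (Real.exp_pos (-1 / τ)).le n)
  refine h1.trans ((div_le_div_of_nonneg_right (h2.trans h3) zero_le_two).trans_eq ?_)
  rw [mul_div_cancel_right₀ _ two_ne_zero]

theorem tsum_sub_tsum_le_of_geometric {f g : ℕ → ℝ} {r : ℝ} (hf : Summable f) (hg : Summable g)
    (hr0 : 0 ≤ r) (hr1 : r < 1) (h : ∀ n, f (n + 1) - g (n + 1) ≤ r ^ n) :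
    ∑' n, f n - ∑' n, g n ≤ f 0 - g 0 + (1 - r)⁻¹ := by
  have hf' := (summable_nat_add_iff 1).2 hf
  have hg' := (summable_nat_add_iff 1).2 hg
  have hle := (hf'.sub hg').tsum_le_tsum h (summable_geometric_of_lt_one hr0 hr1)
  rw [hf'.tsum_sub hg', tsum_geometric_of_lt_one hr0 hr1] at hle
  rw [hf.tsum_eq_zero_add, hg.tsum_eq_zero_add]
  linarith

/-- The accumulated losses of two actions differ by at most `3 * τ`. -/
theorem Q_sub_Q_le (hτ : 1 ≤ τ) (hP : HasMixingTime P τ) (π : Policy S A) {l : S × A → ℝ}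
    (hl : ∀ z, l z ∈ Set.Icc (0 : ℝ) 1) (s : S) (a b : A) :
    Q P π l s a - Q P π l s b ≤ 3 * τ := by
  have hτ0 : 0 < τ := by linarith
  have hsum := summable_relative_loss hτ0 hP π l
  refine (tsum_sub_tsum_le_of_geometric (hsum (s, a)) (hsum (s, b)) (Real.exp_pos (-1 / τ)).le
    (exp_neg_one_div_lt_one hτ0) fun n => ?_).trans ?_
  · rw [sub_sub_sub_cancel_right]
    exact pairMatrix_pow_succ_mulVec_sub_le hP π hl _ _ n
  -- Time `0` contributes at most `1` and the tail at most `τ + 1`; `τ + 2 ≤ 3 * τ` since `1 ≤ τ`.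
  · rw [sub_sub_sub_cancel_right, pow_zero, one_mulVec]
    linarith [one_sub_exp_inv_le hτ0, (hl (s, a)).2, (hl (s, b)).1]

/-- The performance difference lemma. -/
theorem pairing_stationaryDist_sub (hτ : 0 < τ) (hP : HasMixingTime P τ) (π : Policy S A)
    (l : S × A → ℝ) {π' : Policy S A} {σ : S → ℝ} (hσ : σ ∈ stdSimplex ℝ S)
    (hinv : σ ᵥ* stateMatrix P π' = σ)
    (hd : ∀ z, stationaryDist P π' z = σ z.1 * π' z.1 z.2) :
    pairing l (stationaryDist P π) - pairing l (stationaryDist P π')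
      = ∑ s, σ s * ∑ a, (π s a - π' s a) * Q P π l s a := by
  set ρ := pairing l (stationaryDist P π) with hρ
  set v : S → ℝ := fun s' => ∑ a', π s' a' * Q P π l s' a' with hv
  have hπ1 : ∀ s, ∑ a, π' s a = 1 := fun s => (π' s).2.2
  have hmean : ∀ s, ∑ a, π' s a * Q P π l s a
      = policyMean π' l s - ρ + (stateMatrix P π' *ᵥ v) s := by
    intro s
    have h1 : ∀ a, π' s a * Q P π l s a
        = π' s a * l (s, a) - π' s a * ρ + ∑ s', π' s a * P s a s' * v s' := by
      intro a
      rw [Q_eq hτ hP, mul_add, mul_sub, Finset.mul_sum]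
      simp_rw [mul_assoc]
      rfl
    simp_rw [h1]
    rw [Finset.sum_add_distrib, Finset.sum_sub_distrib, ← Finset.sum_mul, hπ1, one_mul,
      Finset.sum_comm]
    simp [policyMean, mulVec, dotProduct, stateMatrix, Finset.sum_mul]
  -- Averaged over `σ`, the future term of the Poisson equation equals the `σ`-mean of `v`, so it
  -- cancels against the `π`-mean of `Q`.
  have hinv' : σ ⬝ᵥ (stateMatrix P π' *ᵥ v) = σ ⬝ᵥ v := by rw [dotProduct_mulVec, hinv]
  simp_rw [sub_mul, Finset.sum_sub_distrib, hmean]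
  rw [pairing_eq_dotProduct_policyMean hd]
  simp only [mul_sub, mul_add, Finset.sum_sub_distrib, Finset.sum_add_distrib, ← Finset.sum_mul,
    hσ.2]
  simp only [dotProduct] at hinv' ⊢
  rw [hinv']
  simp [hv]

end PerformanceDifference

end OnlineMDP

namespace OnlineMDP

/-! ### The strategy sets and the agent's regret -/

section Equilibrium

open Matrix

variable {S A : Type*}

theorem timeAverage_mem {s : Set (S × A → ℝ)} (hs : Convex ℝ s) {T : ℕ} (hT : 1 ≤ T)
    {f : ℕ → S × A → ℝ} (hf : ∀ t, f t ∈ s) : timeAverage T f ∈ s := by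
  have hT0 : (T : ℝ) ≠ 0 := by positivity
  rw [timeAverage, Finset.smul_sum]
  exact hs.sum_mem (fun _ _ => by positivity) (by simp [hT0]) fun t _ => hf t

theorem convex_lossSimplex {L : ℕ} (ℓ : Fin L → S × A → ℝ) : Convex ℝ (lossSimplex ℓ) := by
  rintro _ ⟨x, hx, rfl⟩ _ ⟨y, hy, rfl⟩ a b ha hb hab
  refine ⟨a • x + b • y, convex_stdSimplex ℝ _ hx hy ha hb hab, ?_⟩
  simp [Finset.smul_sum, add_smul, Finset.sum_add_distrib, mul_smul]

theorem mem_Icc_of_mem_lossSimplex {L : ℕ} {ℓ : Fin L → S × A → ℝ}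
    (hℓ : ∀ i z, ℓ i z ∈ Set.Icc (0 : ℝ) 1) {l : S × A → ℝ} (hl : l ∈ lossSimplex ℓ)
    (z : S × A) : l z ∈ Set.Icc (0 : ℝ) 1 := by
  obtain ⟨x, hx, rfl⟩ := hl
  have h := (convex_Icc (0 : ℝ) 1).sum_mem (fun i _ => hx.1 i) hx.2 fun i _ => hℓ i z
  simpa using h

variable [Fintype S] [Fintype A]

theorem isLinearMap_pairing (l : S × A → ℝ) : IsLinearMap ℝ (pairing l) where
  map_add d d' := by simp [pairing, mul_add, Finset.sum_add_distrib]
  map_smul c d := by simp [pairing, Finset.mul_sum, mul_left_comm]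

theorem pairing_comm (l d : S × A → ℝ) : pairing l d = pairing d l := by
  simp [pairing, mul_comm]

theorem pairing_timeAverage_right (T : ℕ) (l : S × A → ℝ) (f : ℕ → S × A → ℝ) :
    pairing l (timeAverage T f) = (T : ℝ)⁻¹ * ∑ t ∈ Finset.range T, pairing l (f t) := by
  rw [timeAverage, (isLinearMap_pairing l).map_smul, smul_eq_mul]
  congr 1
  exact map_sum ((isLinearMap_pairing l).mk' _) _ _

theorem pairing_timeAverage_left (T : ℕ) (f : ℕ → S × A → ℝ) (d : S × A → ℝ) :
    pairing (timeAverage T f) d = (T : ℝ)⁻¹ * ∑ t ∈ Finset.range T, pairing (f t) d := by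
  simp only [pairing_comm _ d, pairing_timeAverage_right]

/-- Finiteness makes the hull of the stationary distributions closed, as strict separation requires.
-/
theorem finite_isDeterministic : {π : Policy S A | π.IsDeterministic}.Finite := by
  classical
  refine (Set.finite_range fun (f : S → A) (s : S) =>
    (⟨Pi.single (f s) 1, single_mem_stdSimplex ℝ (f s)⟩ : stdSimplex ℝ A)).subset fun π hπ => ?_
  choose f hf using hπ
  refine ⟨f, funext fun s => Subtype.ext (funext fun b => ?_)⟩
  have h1 : ∑ b, π s b = 1 := (π s).2.2
  change (Pi.single (f s) 1 : A → ℝ) b = π s b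
  rcases eq_or_ne b (f s) with rfl | hb
  · simp [hf]
  · rw [Pi.single_eq_of_ne hb]
    rw [← Finset.add_sum_erase _ _ (Finset.mem_univ (f s)), hf, add_eq_left,
      Finset.sum_eq_zero_iff_of_nonneg (f := fun b => π s b) fun b _ => (π s).2.1 b] at h1
    exact (h1 b (by simp [hb])).symm

variable [DecidableEq S] [Nonempty S] [DecidableEq A] {P : Transition S A} {τ : ℝ}

/-- Policy improvement: the greedy policy with respect to the accumulated loss of `π` is
deterministic and has at most the average loss of `π`. -/
theorem exists_isDeterministic_pairing_le [Nonempty A] (hτ : 0 < τ) (hP : HasMixingTime P τ)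
    (π : Policy S A) (l : S × A → ℝ) : ∃ π' : Policy S A, π'.IsDeterministic ∧
      pairing l (stationaryDist P π') ≤ pairing l (stationaryDist P π) := by
  choose f hf using fun s => Finite.exists_min (Q P π l s)
  let π' : Policy S A := fun s => ⟨Pi.single (f s) 1, single_mem_stdSimplex ℝ (f s)⟩
  have hπ' : ∀ s a, π' s a = (Pi.single (f s) 1 : A → ℝ) a := fun _ _ => rfl
  refine ⟨π', fun s => ⟨f s, by simp [hπ']⟩, ?_⟩
  obtain ⟨σ, hσ, hinv, hd⟩ := exists_invariant_stateDist hτ hP π'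
  rw [← sub_nonneg, pairing_stationaryDist_sub hτ hP π l hσ hinv hd]
  refine Finset.sum_nonneg fun s _ => mul_nonneg (hσ.1 s) ?_
  have h1 : ∑ a, π s a = 1 := (π s).2.2
  have h2 : ∑ a, π' s a * Q P π l s a = Q P π l s (f s) := by
    simp [hπ', Pi.single_apply]
  simp_rw [sub_mul]
  rw [Finset.sum_sub_distrib, h2, sub_nonneg, ← one_mul (Q P π l s (f s)), ← h1, Finset.sum_mul]
  exact Finset.sum_le_sum fun a _ => mul_le_mul_of_nonneg_left (hf s a) ((π s).2.1 a)

/-- Otherwise a linear functional is strictly smaller at `d_π` than on the hull. Read as a loss, it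
contradicts policy improvement, which finds a deterministic policy doing at least as well as `π`. -/
theorem stationaryDist_mem_stationaryHull [Nonempty A] (hτ : 0 < τ) (hP : HasMixingTime P τ)
    (π : Policy S A) : stationaryDist P π ∈ stationaryHull P := by
  by_contra hmem
  have hfin : {d | ∃ π : Policy S A, π.IsDeterministic ∧ d = stationaryDist P π}.Finite :=
    (finite_isDeterministic.image (stationaryDist P)).subset
      fun _ ⟨π', hπ', h⟩ => ⟨π', hπ', h.symm⟩
  obtain ⟨g, u, hu, hg⟩ := geometric_hahn_banach_point_closed (convex_convexHull ℝ _)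
    (hfin.isClosed_convexHull ℝ) hmem
  have hpair : ∀ d, g d = pairing (fun z => g (Pi.single z 1)) d := fun d => by
    rw [← ContinuousLinearMap.coe_coe, LinearMap.pi_apply_eq_sum_univ]
    simp only [pairing, smul_eq_mul, ContinuousLinearMap.coe_coe]
    refine Finset.sum_congr rfl fun z _ => ?_
    rw [mul_comm]
    congr 2
    ext w
    simp [Pi.single_apply, eq_comm]
  obtain ⟨π', hdet, hle⟩ :=
    exists_isDeterministic_pairing_le hτ hP π fun z => g (Pi.single z 1)
  rw [← hpair, ← hpair] at hle
  exact absurd (hg _ (subset_convexHull ℝ _ ⟨π', hdet, rfl⟩)) (by linarith)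

/-- The regret bound of MDP-Expert with respect to the stationary distribution of a policy. -/
theorem IsMDPExpert.regret_le [Nonempty A] (hτ : 1 ≤ τ) (hP : HasMixingTime P τ)
    {l : ℕ → S × A → ℝ} (hl : ∀ t z, l t z ∈ Set.Icc (0 : ℝ) 1) {T : ℕ} (hT : 1 ≤ T)
    {π : ℕ → Policy S A}
    (hπ : IsMDPExpert P (√(8 * Real.log (Fintype.card A) / T) / (3 * τ)) l π)
    (π' : Policy S A) :
    ∑ t ∈ Finset.range T, pairing (l t) (stationaryDist P (π t))
      - ∑ t ∈ Finset.range T, pairing (l t) (stationaryDist P π')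
      ≤ T * (3 * τ * √(Real.log (Fintype.card A) / (2 * T))) := by
  have hτ0 : 0 < τ := by linarith
  obtain ⟨σ, hσ, hinv, hd⟩ := exists_invariant_stateDist hτ0 hP π'
  rw [← Finset.sum_sub_distrib]
  -- The weights `σ` belong to the fixed comparator `π'`, so the sums over rounds and states can be
  -- exchanged.
  simp_rw [fun t => pairing_stationaryDist_sub hτ0 hP (π t) (l t) hσ hinv hd]
  rw [Finset.sum_comm]
  simp_rw [← Finset.mul_sum]
  have hreg : ∀ s, ∑ t ∈ Finset.range T, ∑ a, (π t s a - π' s a) * Q P (π t) (l t) s a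
      ≤ T * (3 * τ * √(Real.log (Fintype.card A) / (2 * T))) := fun s =>
    mwu_regret_le_of_tuned (p := fun t => π t s) (k := fun t => Q P (π t) (l t) s)
      (by positivity) hT (hπ.1 s) (fun t => hπ.2 t s)
      (fun t => Q_sub_Q_le hτ hP (π t) (hl t) s) (π' s)
  calc _ ≤ ∑ s, σ s * (T * (3 * τ * √(Real.log (Fintype.card A) / (2 * T)))) :=
        Finset.sum_le_sum fun s _ => mul_le_mul_of_nonneg_left (hreg s) (hσ.1 s)
    _ = _ := by rw [← Finset.sum_mul, hσ.2, one_mul]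

end Equilibrium

end OnlineMDP

theorem mainTheorem3 {S A : Type*} [Fintype S] [DecidableEq S] [Nonempty S]
    [Fintype A] [DecidableEq A] [Nonempty A]
    (P : OnlineMDP.Transition S A) (τ : ℝ) (hτ : 1 ≤ τ) (hP : OnlineMDP.HasMixingTime P τ)
    {L : ℕ} (ℓ : Fin L → S × A → ℝ) (hℓ : ∀ i z, ℓ i z ∈ Set.Icc (0 : ℝ) 1)
    (adv : OnlineMDP.Adversary S A ℓ) (T : ℕ) (hT : 1 ≤ T)
    (π : ℕ → OnlineMDP.Policy S A)
    (hπ : OnlineMDP.IsMDPExpert P (√(8 * Real.log (Fintype.card A) / T) / (3 * τ))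
      (adv.loss π) π)
    (hadv : ∀ l ∈ OnlineMDP.lossSimplex ℓ,
      OnlineMDP.adversaryRegret P π (adv.loss π) T l ≤ √(T * Real.log L / 2)) :
    OnlineMDP.IsEpsNash P ℓ
      (√(Real.log L / (2 * T)) + 3 * τ * √(Real.log (Fintype.card A) / (2 * T)))
      (OnlineMDP.timeAverage T (adv.loss π))
      (OnlineMDP.timeAverage T fun t => OnlineMDP.stationaryDist P (π t)) := by
  have hτ0 : 0 < τ := by linarith
  have hT0 : (0 : ℝ) < T := by exact_mod_cast hT
  have hloss : ∀ t, adv.loss π t ∈ OnlineMDP.lossSimplex ℓ := fun t => (adv t _).2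
  have hl := OnlineMDP.timeAverage_mem (OnlineMDP.convex_lossSimplex ℓ) hT hloss
  have hd := OnlineMDP.timeAverage_mem (convex_convexHull ℝ _) hT fun t =>
    OnlineMDP.stationaryDist_mem_stationaryHull hτ0 hP (π t)
  set c := (T : ℝ)⁻¹ * ∑ t ∈ Finset.range T,
    OnlineMDP.pairing (adv.loss π t) (OnlineMDP.stationaryDist P (π t)) with hc
  have hmax : ∀ l ∈ OnlineMDP.lossSimplex ℓ, OnlineMDP.pairing l
      (OnlineMDP.timeAverage T fun t => OnlineMDP.stationaryDist P (π t))
        ≤ c + √(Real.log L / (2 * T)) := by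
    intro l hl
    have h := hadv l hl
    have hsqrt : √(T * Real.log L / 2) = T * √(Real.log L / (2 * T)) := by
      rw [show (T : ℝ) * Real.log L / 2 = T ^ 2 * (Real.log L / (2 * T)) by field_simp,
        Real.sqrt_mul (by positivity), Real.sqrt_sq hT0.le]
    rw [OnlineMDP.adversaryRegret, hsqrt] at h
    rw [OnlineMDP.pairing_timeAverage_right, hc, inv_mul_le_iff₀ hT0, mul_add,
      mul_inv_cancel_left₀ hT0.ne']
    linarith
  have hmin : ∀ d ∈ OnlineMDP.stationaryHull P,
      c - 3 * τ * √(Real.log (Fintype.card A) / (2 * T))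
        ≤ OnlineMDP.pairing (OnlineMDP.timeAverage T (adv.loss π)) d := by
    -- The bound defines a half-space in `d`, so it suffices to check the generators.
    refine convexHull_min ?_ (convex_halfSpace_ge (OnlineMDP.isLinearMap_pairing _) _)
    rintro _ ⟨π', -, rfl⟩
    have h := hπ.regret_le hτ hP
      (fun t => OnlineMDP.mem_Icc_of_mem_lossSimplex hℓ (hloss t)) hT π'
    change _ ≤ OnlineMDP.pairing _ (OnlineMDP.stationaryDist P π')
    rw [OnlineMDP.pairing_timeAverage_left, hc, le_inv_mul_iff₀ hT0, mul_sub,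
      mul_inv_cancel_left₀ hT0.ne']
    linarith
  -- Each inequality adds the two regret bounds, one of them taken at `d̂` or `l̂` itself.
  exact ⟨hl, hd, fun l' hl' => by linarith [hmax l' hl', hmin _ hd],
    fun d' hd' => by linarith [hmax _ hl, hmin d' hd']⟩
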